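/- Let $\mathbf\Phi=\{\Phi_k,k\ge 0\}$ be an irreducible, positive recurrent discrete-time Markov chain on a countable state space $E$ with transition matrix $P$ and invariant probability vector $\boldsymbol\pi$; no further moment condition on return times is assumed. Let $\mathbb P_i,\mathbb E_i$ denote probability and expectation for the chain started from $i$, let $\boldsymbol e$ denote a column vector of ones, and put $\tau_S:=\inf\{k\ge 1:\Phi_k\in S\}$ for $S\subseteq E$, $\tau_\alpha:=\tau_{\{\alpha\}}$. Let $A$ be a finite non-empty subset of $E$ with complement $B$, partition $P$ into the blocks $P_{AA},P_{AB},P_{BA},P_{BB}$ accordingly, and put $\widehat P_{BB}:=\sum_{k\ge 0}P_{BB}^k$. Let $P^{(A)}$ be the transition matrix of the chain censored on $A$ (the chain observed only at its successive visits to $A$), that is, $P^{(A)}(i,j)=\mathbb P_i(\tau_A<\infty,\,\Phi_{\tau_A}=j)$ for $i,j\in A$; it equals $P_{AA}+P_{AB}\widehat P_{BB}P_{BA}$. For a finite square matrix $W$ let $W^{\#}$ be its group inverse, i.e. the unique matrix (if it exists) with $WW^{\#}W=W$, $W^{\#}WW^{\#}=W^{\#}$, $W^{\#}W=WW^{\#}$.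 Define the $E\times E$ matrix $\widetilde X$, with row blocks $\widetilde X_A$ (rows in $A$) and $\widetilde X_B$ (rows in $B$), by $$\widetilde X_A=\left(I-P^{(A)}\right)^{\#}\left(\left[I,\,P_{AB}\widehat P_{BB}\right]-\left(\boldsymbol e+P_{AB}\widehat P_{BB}\boldsymbol e\right)\boldsymbol\pi^T\right),$$ $$\widetilde X_B=\widehat P_{BB}P_{BA}\widetilde X_A+\left[O,\,\widehat P_{BB}\right]-\widehat P_{BB}\boldsymbol e\,\boldsymbol\pi^T .$$ Fix $\alpha\in A$ and let $$K(i,j)=\mathbb E_i\left[\sum_{k=0}^{\tau_\alpha-1}\left(\mathbf 1\{\Phi_k=j\}-\pi(j)\right)\right],\qquad i,j\in E.$$ Then all these quantities are well defined ($\tau_\alpha<\infty$ almost surely under every $\mathbb P_i$, the random variables in the definition of $K$ are integrable, $\widehat P_{BB}\boldsymbol e$ and $P_{AB}\widehat P_{BB}\boldsymbol e$ are finite, and $(I-P^{(A)})^{\#}$ exists), and $$K=\widetilde X-\boldsymbol e\boldsymbol\beta^T,\qquad\text{where }\beta(j)=\widetilde X(\alpha,j)\text{ for all }j\in E .$$ 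-/

import Mathlib

open MeasureTheory
open scoped ENNReal

namespace CensoredPoisson

noncomputable section

/-! ### Matrices with possibly infinite index sets -/

/-- Product of nonnegative, possibly infinite matrices; the sums are taken in `[0, ∞]`. -/
def infMul {l m n : Type*} (M : Matrix l m ℝ≥0∞) (N : Matrix m n ℝ≥0∞) : Matrix l n ℝ≥0∞ :=
  fun i j => ∑' k, M i k * N k j

/-- Powers of a nonnegative, possibly infinite square matrix. -/
def infPow {m : Type*} [DecidableEq m] (M : Matrix m m ℝ≥0∞) : ℕ → Matrix m m ℝ≥0∞
  | 0 => 1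
  | k + 1 => infMul (infPow M k) M

/-- The vector `M e` of row sums of a nonnegative matrix, `e` being the vector of ones. -/
def rowSum {l m : Type*} (M : Matrix l m ℝ≥0∞) : l → ℝ≥0∞ :=
  fun i => ∑' j, M i j

/-- `G` is a group inverse of the finite square matrix `W`:
`W G W = W`, `G W G = G` and `G W = W G`. -/
structure IsGroupInverse {m : Type*} [Fintype m] (W G : Matrix m m ℝ) : Prop where
  mul_mul_self : W * G * W = W
  self_mul_mul : G * W * G = G
  comm : G * W = W * G

/-- A matrix has at most one group inverse. -/
theorem IsGroupInverse.unique {m : Type*} [Fintype m] {W G H : Matrix m m ℝ}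
    (hG : IsGroupInverse W G) (hH : IsGroupInverse W H) : G = H := by
  have h1 : G * W = (G * W) * (H * W) := by
    calc G * W = G * (W * H * W) := by rw [hH.mul_mul_self]
      _ = (G * W) * (H * W) := by simp only [Matrix.mul_assoc]
  have h2 : H * W = (G * W) * (H * W) := by
    calc H * W = W * H := hH.comm
      _ = (W * G * W) * H := by rw [hG.mul_mul_self]
      _ = (W * G) * (W * H) := by simp only [Matrix.mul_assoc]
      _ = (G * W) * (H * W) := by rw [hG.comm, hH.comm]
  have h3 : G * W = H * W := h1.trans h2.symm
  calc G = G * W * G := hG.self_mul_mul.symm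
    _ = H * (W * G) := by rw [h3, Matrix.mul_assoc]
    _ = H * W * H := by rw [← hG.comm, h3, hH.comm, ← Matrix.mul_assoc, ← hH.comm,
        Matrix.mul_assoc, ← hH.comm, ← Matrix.mul_assoc]
    _ = H := hH.self_mul_mul

open Classical in
/-- The group inverse of a finite square matrix (the zero matrix if there is none). -/
def groupInverse {m : Type*} [Fintype m] (W : Matrix m m ℝ) : Matrix m m ℝ :=
  if h : ∃ G, IsGroupInverse W G then h.choose else 0

/-! ### Discrete-time Markov chains -/

/-- The transition matrix of a family of one-step transition laws:
`transitionMatrix P i j` is the probability of a jump from `i` to `j`. -/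
def transitionMatrix {E : Type*} (P : E → PMF E) : Matrix E E ℝ≥0∞ :=
  fun i j => P i j

/-- `Φ` is a time-homogeneous Markov chain with transition probabilities `P`; under the probability
measure `μ i` it starts from the state `i`. -/
structure IsMarkovChain {E Ω : Type*} [MeasurableSpace E] [MeasurableSpace Ω]
    (P : E → PMF E) (μ : E → Measure Ω) (Φ : ℕ → Ω → E) : Prop where
  isProbabilityMeasure : ∀ i, IsProbabilityMeasure (μ i)
  measurable : ∀ n, Measurable (Φ n)
  start : ∀ i, ∀ᵐ ω ∂(μ i), Φ 0 ω = i
  markov : ∀ (i : E) (n : ℕ) (x : ℕ → E),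
    μ i {ω | ∀ k ≤ n + 1, Φ k ω = x k} =
      μ i {ω | ∀ k ≤ n, Φ k ω = x k} * P (x n) (x (n + 1))

/-- Every state can be reached from every state with positive probability. -/
def IsIrreducible {E : Type*} [DecidableEq E] (P : E → PMF E) : Prop :=
  ∀ i j, ∃ n : ℕ, 0 < infPow (transitionMatrix P) n i j

/-- The first return time `τ_S = inf {k ≥ 1 : Φ_k ∈ S}`, with values in `ℕ ∪ {∞}`. -/
def returnTime {E Ω : Type*} (Φ : ℕ → Ω → E) (S : Set E) : Ω → ℕ∞ :=
  hittingAfter Φ S 1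

/-- Positive recurrence: all mean return times `𝔼_i[τ_i]` are finite. -/
def IsPositiveRecurrent {E Ω : Type*} [MeasurableSpace Ω]
    (μ : E → Measure Ω) (Φ : ℕ → Ω → E) : Prop :=
  ∀ i, ∫⁻ ω, (returnTime Φ {i} ω : ℝ≥0∞) ∂(μ i) < ∞

/-- `p` is an invariant probability vector: `∑ i, p i * P i j = p j` for every `j`. -/
def IsInvariant {E : Type*} (P : E → PMF E) (p : PMF E) : Prop :=
  ∀ j, ∑' i, p i * P i j = p j

/-- The random variable `∑_{k < τ_a} (1{Φ_k = j} - p j)` (with value `0` where `τ_a = ∞`). -/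
def additiveFunctional {E Ω : Type*} [DecidableEq E] (p : PMF E) (Φ : ℕ → Ω → E)
    (a j : E) (ω : Ω) : ℝ :=
  ∑ k ∈ Finset.range (returnTime Φ {a} ω).toNat,
    ((if Φ k ω = j then 1 else 0) - (p j).toReal)

/-- The expected additive-type functional matrix
`K_a(i, j) = 𝔼_i[∑_{k < τ_a} (1{Φ_k = j} - p j)]`. -/
def additiveMatrix {E Ω : Type*} [DecidableEq E] [MeasurableSpace Ω] (p : PMF E)
    (μ : E → Measure Ω) (Φ : ℕ → Ω → E) (a : E) : Matrix E E ℝ :=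
  fun i j => ∫ ω, additiveFunctional p Φ a j ω ∂(μ i)

/-! ### Censoring on a finite set `A`, with complement `B` -/

section Censoring

variable {E : Type*} [DecidableEq E] (P : E → PMF E) (A : Finset E)

/-- The block `P_AA` of the transition matrix. -/
def blockAA : Matrix {x // x ∈ A} {x // x ∈ A} ℝ≥0∞ := fun i j => P i j

/-- The block `P_AB` of the transition matrix. -/
def blockAB : Matrix {x // x ∈ A} {x // x ∉ A} ℝ≥0∞ := fun i j => P i j

/-- The block `P_BA` of the transition matrix. -/
def blockBA : Matrix {x // x ∉ A} {x // x ∈ A} ℝ≥0∞ := fun i j => P i j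

/-- The block `P_BB` of the transition matrix. -/
def blockBB : Matrix {x // x ∉ A} {x // x ∉ A} ℝ≥0∞ := fun i j => P i j

/-- `P̂_BB = ∑_{k ≥ 0} P_BB ^ k`. -/
def hatBB : Matrix {x // x ∉ A} {x // x ∉ A} ℝ≥0∞ :=
  fun i j => ∑' k : ℕ, infPow (blockBB P A) k i j

/-- The product `P_AB P̂_BB`. -/
def hatAB : Matrix {x // x ∈ A} {x // x ∉ A} ℝ≥0∞ :=
  infMul (blockAB P A) (hatBB P A)

/-- The transition matrix `P^(A)` of the chain censored on `A`, that is, of the chain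
`Φ_{θ_0}, Φ_{θ_1}, …` where `θ_k` are the successive times of visits to `A`. For a start in a state
`i` of `A` one has `θ_0 = 0` and `θ_1 = τ_A`, so its entry at `(i, j)` is
`ℙ_i(τ_A < ∞, Φ_{τ_A} = j)`. -/
def censored {Ω : Type*} [MeasurableSpace Ω] (μ : E → Measure Ω) (Φ : ℕ → Ω → E) :
    Matrix {x // x ∈ A} {x // x ∈ A} ℝ≥0∞ :=
  fun i j => μ i {ω | returnTime Φ A ω ≠ ⊤ ∧ Φ (returnTime Φ A ω).toNat ω = j}

/-- The row of blocks `[M, N]`, the columns of `M` being indexed by `A`, those of `N` by `B`. -/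
def hcat {l : Type*} (M : Matrix l {x // x ∈ A} ℝ) (N : Matrix l {x // x ∉ A} ℝ) :
    Matrix l E ℝ :=
  fun i j => if h : j ∈ A then M i ⟨j, h⟩ else N i ⟨j, h⟩

/-- The matrix `I - P^(A)`, with real entries. -/
def oneSubCensored {Ω : Type*} [MeasurableSpace Ω] (μ : E → Measure Ω) (Φ : ℕ → Ω → E) :
    Matrix {x // x ∈ A} {x // x ∈ A} ℝ :=
  1 - (censored A μ Φ).map ENNReal.toReal

/-- `X̃_A = (I - P^(A))^# ([I, P_AB P̂_BB] - (e + P_AB P̂_BB e) pᵀ)`. -/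
def solutionA {Ω : Type*} [MeasurableSpace Ω] (μ : E → Measure Ω) (Φ : ℕ → Ω → E)
    (p : PMF E) : Matrix {x // x ∈ A} E ℝ :=
  groupInverse (oneSubCensored A μ Φ) *
    (hcat A 1 ((hatAB P A).map ENNReal.toReal) -
      Matrix.vecMulVec (fun i => 1 + (rowSum (hatAB P A) i).toReal) (fun j => (p j).toReal))

/-- `X̃_B = P̂_BB P_BA X̃_A + [O, P̂_BB] - P̂_BB e pᵀ`. -/
def solutionB {Ω : Type*} [MeasurableSpace Ω] (μ : E → Measure Ω) (Φ : ℕ → Ω → E)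
    (p : PMF E) : Matrix {x // x ∉ A} E ℝ :=
  (infMul (hatBB P A) (blockBA P A)).map ENNReal.toReal * solutionA P A μ Φ p +
      hcat A 0 ((hatBB P A).map ENNReal.toReal) -
    Matrix.vecMulVec (fun i => (rowSum (hatBB P A) i).toReal) (fun j => (p j).toReal)

/-- The matrix `X̃` with blocks of rows `X̃_A` and `X̃_B`. -/
def solution {Ω : Type*} [MeasurableSpace Ω] (μ : E → Measure Ω) (Φ : ℕ → Ω → E)
    (p : PMF E) : Matrix E E ℝ :=
  fun i j => if h : i ∈ A then solutionA P A μ Φ p ⟨i, h⟩ j else solutionB P A μ Φ p ⟨i, h⟩ j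

end Censoring

end

end CensoredPoisson

namespace CensoredPoisson

noncomputable section

/-! ### Arithmetic of infinite nonnegative matrices -/

section InfMul

variable {k l m n : Type*}

/-! Let G_S be the Green matrix of the chain killed on its return to S (`green`): G_S(i,j) is the
mean number of k < τ_S with Φ_k = j, and G_S e is the vector of mean return times. Put C_S = G_S -
(G_S e) πᵀ (`centeredGreen`). Then K = C_{α}, the matrices built from P̂_BB are parts of G_A, and
the right-hand factor of X̃_A consists of the rows of C_A in A.

Cutting the path at τ_A gives G_α = G_A + H 1_{A∖α} G_α, where H is the law of Φ_{τ_A}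
(`green_eq_infMul`). By the cycle formula (`green_self_eq`) row α of C_α vanishes, so after
centering the restriction to A∖α can be dropped: K = C_A + H K_A, with K_A the rows of K in A
(`centeredGreen_singleton_eq`). On A this reads W K_A = C_A with W = I - P^(A). Hence X̃_A = W^# W
K_A and W (X̃_A - K_A) = 0. The kernel of W consists of constant vectors, so X̃_A - K_A = e βᵀ, and
row α identifies β. By definition X̃_B satisfies the same relation as the rows of K in B; since the
rows of H sum to one, the same β appears there.

The Green matrices are handled in [0, ∞], where sums can be interchanged freely. Finiteness comes
from 𝔼_α[τ_α] < ∞ alone, which irreducibility carries to every starting state. -/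

theorem infMul_assoc (M : Matrix k l ℝ≥0∞) (N : Matrix l m ℝ≥0∞) (R : Matrix m n ℝ≥0∞) :
    infMul (infMul M N) R = infMul M (infMul N R) := by
  ext i j
  simp only [infMul, ← ENNReal.tsum_mul_left, ← ENNReal.tsum_mul_right]
  rw [ENNReal.tsum_comm]
  simp only [mul_assoc]

theorem one_infMul [DecidableEq m] (M : Matrix m n ℝ≥0∞) : infMul 1 M = M := by
  ext i j
  simp only [infMul]
  rw [tsum_eq_single i (fun b hb => by simp [Matrix.one_apply_ne hb.symm])]
  simp

theorem infMul_one [DecidableEq m] (M : Matrix l m ℝ≥0∞) : infMul M 1 = M := by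
  ext i j
  simp only [infMul]
  rw [tsum_eq_single j (fun b hb => by simp [Matrix.one_apply_ne hb])]
  simp

theorem infMul_add (M : Matrix l m ℝ≥0∞) (N R : Matrix m n ℝ≥0∞) :
    infMul M (N + R) = infMul M N + infMul M R := by
  ext i j
  simp only [infMul, Matrix.add_apply, mul_add, ENNReal.tsum_add]

theorem add_infMul (M N : Matrix l m ℝ≥0∞) (R : Matrix m n ℝ≥0∞) :
    infMul (M + N) R = infMul M R + infMul N R := by
  ext i j
  simp only [infMul, Matrix.add_apply, add_mul, ENNReal.tsum_add]

theorem infMul_mono {M M' : Matrix l m ℝ≥0∞} {N N' : Matrix m n ℝ≥0∞}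
    (hM : ∀ i j, M i j ≤ M' i j) (hN : ∀ i j, N i j ≤ N' i j) (i : l) (j : n) :
    infMul M N i j ≤ infMul M' N' i j :=
  ENNReal.tsum_le_tsum fun _ => mul_le_mul' (hM _ _) (hN _ _)

theorem rowSum_infMul (M : Matrix l m ℝ≥0∞) (N : Matrix m n ℝ≥0∞) (i : l) :
    rowSum (infMul M N) i = ∑' r, M i r * rowSum N r := by
  simp only [rowSum, infMul, ← ENNReal.tsum_mul_left]
  rw [ENNReal.tsum_comm]

theorem rowSum_add (M N : Matrix l m ℝ≥0∞) (i : l) :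
    rowSum (M + N) i = rowSum M i + rowSum N i := by
  simp only [rowSum, Matrix.add_apply, ENNReal.tsum_add]

theorem rowSum_one [DecidableEq m] (i : m) : rowSum (1 : Matrix m m ℝ≥0∞) i = 1 := by
  simp only [rowSum]
  rw [tsum_eq_single i (fun b hb => by simp [Matrix.one_apply_ne hb.symm])]
  simp

theorem apply_le_rowSum (M : Matrix l m ℝ≥0∞) (i : l) (j : m) : M i j ≤ rowSum M i :=
  ENNReal.le_tsum (f := fun j => M i j) j

end InfMul

/-! ### Potentials -/

section Potential

variable {l m n : Type*} [DecidableEq m]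

theorem infPow_succ' (M : Matrix m m ℝ≥0∞) (k : ℕ) :
    infPow M (k + 1) = infMul M (infPow M k) := by
  induction k with
  | zero => simp only [infPow, one_infMul, infMul_one]
  | succ k ih =>
    rw [infPow, ih, infMul_assoc, ← ih]
    rfl

/-- The potential `∑ k, M ^ k` of a nonnegative matrix. -/
def potential (M : Matrix m m ℝ≥0∞) : Matrix m m ℝ≥0∞ :=
  fun i j => ∑' k : ℕ, infPow M k i j

theorem potential_eq_one_add (M : Matrix m m ℝ≥0∞) :
    potential M = 1 + infMul M (potential M) := by
  ext i j
  simp only [potential, Matrix.add_apply, infMul, ← ENNReal.tsum_mul_left]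
  rw [ENNReal.tsum_comm, tsum_eq_zero_add' ENNReal.summable]
  congr 1
  simp only [infPow_succ']
  rfl

theorem potential_eq_one_add' (M : Matrix m m ℝ≥0∞) :
    potential M = 1 + infMul (potential M) M := by
  ext i j
  simp only [potential, Matrix.add_apply, infMul, ← ENNReal.tsum_mul_right]
  rw [ENNReal.tsum_comm, tsum_eq_zero_add' ENNReal.summable]
  rfl

theorem potential_infMul_apply (M : Matrix m m ℝ≥0∞) (F : Matrix m n ℝ≥0∞) (i : m) (j : n) :
    infMul (potential M) F i j = ∑' k : ℕ, infMul (infPow M k) F i j := by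
  simp only [potential, infMul, ← ENNReal.tsum_mul_right]
  rw [ENNReal.tsum_comm]

theorem infMul_potential_apply (M : Matrix m m ℝ≥0∞) (F : Matrix l m ℝ≥0∞) (i : l) (j : m) :
    infMul F (potential M) i j = ∑' k : ℕ, infMul F (infPow M k) i j := by
  simp only [potential, infMul, ← ENNReal.tsum_mul_left]
  rw [ENNReal.tsum_comm]

/-- `(∑ k, M ^ k) F` is the least solution of `F + M Y ≤ Y`. -/
theorem potential_infMul_le {M : Matrix m m ℝ≥0∞} {F Y : Matrix m n ℝ≥0∞}
    (h : ∀ i j, F i j + infMul M Y i j ≤ Y i j) (i : m) (j : n) :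
    infMul (potential M) F i j ≤ Y i j := by
  rw [potential_infMul_apply]
  -- The partial sums satisfy S_{N+1} = F + M S_N, so S_N ≤ Y gives S_{N+1} ≤ F + M Y ≤ Y; no
  -- finiteness is needed.
  refine ENNReal.tsum_le_of_sum_range_le fun N => ?_
  induction N generalizing i with
  | zero => simp
  | succ N ih =>
    refine le_trans ?_ (h i j)
    rw [Finset.sum_range_succ', add_comm]
    refine add_le_add (by rw [infPow, one_infMul]) ?_
    simp only [infPow_succ', infMul_assoc]
    have : ∑ k ∈ Finset.range N, infMul M (infMul (infPow M k) F) i j =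
        ∑' r, M i r * ∑ k ∈ Finset.range N, infMul (infPow M k) F r j := by
      simp only [Finset.mul_sum]
      rw [Summable.tsum_finsetSum fun _ _ => ENNReal.summable]
      rfl
    rw [this]
    exact ENNReal.tsum_le_tsum fun r => mul_le_mul' le_rfl (ih r)

/-- `F (∑ k, M ^ k)` is the least solution of `F + Y M ≤ Y`. -/
theorem infMul_potential_le {M : Matrix m m ℝ≥0∞} {F Y : Matrix l m ℝ≥0∞}
    (h : ∀ i j, F i j + infMul Y M i j ≤ Y i j) (i : l) (j : m) :
    infMul F (potential M) i j ≤ Y i j := by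
  rw [infMul_potential_apply]
  refine ENNReal.tsum_le_of_sum_range_le fun N => ?_
  induction N generalizing j with
  | zero => simp
  | succ N ih =>
    refine le_trans ?_ (h i j)
    rw [Finset.sum_range_succ', add_comm]
    refine add_le_add (by rw [infPow, infMul_one]) ?_
    simp only [infPow, ← infMul_assoc]
    have : ∑ k ∈ Finset.range N, infMul (infMul F (infPow M k)) M i j =
        ∑' r, (∑ k ∈ Finset.range N, infMul F (infPow M k) i r) * M r j := by
      simp only [Finset.sum_mul]
      rw [Summable.tsum_finsetSum fun _ _ => ENNReal.summable]
      rfl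
    rw [this]
    exact ENNReal.tsum_le_tsum fun r => mul_le_mul' (ih r) le_rfl

/-- First-entrance decomposition of a potential. -/
theorem potential_add (M N : Matrix m m ℝ≥0∞) :
    potential (M + N) = infMul (potential N) (1 + infMul M (potential (M + N))) := by
  set G := potential (M + N) with hG
  set Y := infMul (potential N) (1 + infMul M G) with hY
  have hGeq : G = 1 + infMul M G + infMul N G := by
    conv_lhs => rw [hG, potential_eq_one_add, ← hG, add_infMul]
    rw [add_assoc]
  have hYeq : Y = 1 + infMul M G + infMul N Y := by
    conv_lhs => rw [hY, potential_eq_one_add, add_infMul, one_infMul, infMul_assoc, ← hY]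
  -- Entries may be infinite, so nothing is subtracted; minimality is used twice. `G` solves the
  -- equation of which `Y` is the least solution, so `Y ≤ G`. Then `M Y ≤ M G` makes `Y` a
  -- supersolution of the equation that defines `G`.
  have hYG : ∀ i j, Y i j ≤ G i j := potential_infMul_le fun i j => by
    conv_rhs => rw [hGeq]
    exact le_rfl
  ext i j
  refine le_antisymm ?_ (hYG i j)
  have := potential_infMul_le (M := M + N) (F := 1) (Y := Y) (fun i j => ?_) i j
  · rwa [infMul_one] at this
  · conv_rhs => rw [hYeq]
    rw [add_infMul, Matrix.add_apply, Matrix.add_apply, Matrix.add_apply, ← add_assoc]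
    gcongr
    exact infMul_mono (fun _ _ => le_rfl) hYG i j

end Potential

/-! ### Finite stochastic matrices and group inverses -/

section GroupInverse

theorem isGroupInverse_groupInverse {m : Type*} [Fintype m] {W G : Matrix m m ℝ}
    (h : IsGroupInverse W G) : IsGroupInverse W (groupInverse W) := by
  have h' : ∃ G, IsGroupInverse W G := ⟨G, h⟩
  rw [groupInverse, dif_pos h']
  exact h'.choose_spec

variable {m : Type*} [Fintype m] [DecidableEq m]

/-- A matrix whose kernel is spanned by the vector of ones, which is not in its range, has a group
inverse. -/
theorem exists_isGroupInverse [Nonempty m] {W : Matrix m m ℝ}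
    (h_one : W.mulVec 1 = 0)
    (h_ker : ∀ x, W.mulVec x = 0 → ∃ c : ℝ, x = c • 1)
    (h_range : ∀ x (c : ℝ), W.mulVec x = c • 1 → c = 0) :
    ∃ G, IsGroupInverse W G := by
  -- If (W + 1 vᵀ) x = 0, then W x is constant, hence zero, so x is constant; then v ⬝ᵥ x = 0 forces
  -- x = 0.
  have key : ∀ v : m → ℝ, v ⬝ᵥ 1 ≠ 0 → (W + Matrix.vecMulVec 1 v).det ≠ 0 := by
    intro v hv hdet
    obtain ⟨x, hx0, hx⟩ := Matrix.exists_mulVec_eq_zero_iff.2 hdet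
    rw [Matrix.add_mulVec, Matrix.vecMulVec_mulVec] at hx
    have hWx : W.mulVec x = (-(v ⬝ᵥ x)) • 1 := by
      rw [neg_smul]
      simpa using eq_neg_of_add_eq_zero_left hx
    have h0 := h_range _ _ hWx
    rw [h0, zero_smul] at hWx
    obtain ⟨c, rfl⟩ := h_ker x hWx
    rw [dotProduct_smul, smul_eq_mul, neg_eq_zero, mul_eq_zero] at h0
    rcases h0 with rfl | h0
    · exact hx0 (zero_smul _ _)
    · exact hv h0
  have hdet : W.det = 0 :=
    Matrix.exists_mulVec_eq_zero_iff.1 ⟨1, one_ne_zero, h_one⟩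
  obtain ⟨u, hu0, hu⟩ := Matrix.exists_vecMul_eq_zero_iff.2 hdet
  -- Otherwise `u` would be a left null vector of W + 1 e_aᵀ, which `key` makes nonsingular.
  have hu1 : u ⬝ᵥ 1 ≠ 0 := by
    intro h
    obtain ⟨a⟩ := ‹Nonempty m›
    refine key (Pi.single a 1) (by simp) (Matrix.exists_vecMul_eq_zero_iff.1 ⟨u, hu0, ?_⟩)
    rw [Matrix.vecMul_add, hu, Matrix.vecMul_vecMulVec, h]
    simp
  obtain ⟨v, hv, hv1⟩ : ∃ v : m → ℝ, Matrix.vecMul v W = 0 ∧ v ⬝ᵥ 1 = 1 :=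
    ⟨(u ⬝ᵥ 1)⁻¹ • u, by rw [Matrix.smul_vecMul, hu, smul_zero],
      by rw [smul_dotProduct, smul_eq_mul, inv_mul_cancel₀ hu1]⟩
  -- `J` is the projection onto the kernel of `W` along its range. The group inverse will be (W +
  -- J)⁻¹ - J.
  set J : Matrix m m ℝ := Matrix.vecMulVec 1 v with hJ
  set M := (W + J)⁻¹ with hM
  have hunit : IsUnit (W + J).det := (key v (by rw [hv1]; exact one_ne_zero)).isUnit
  have hJJ : J * J = J := by
    rw [hJ, Matrix.vecMulVec_mul_vecMulVec, hv1, one_smul]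
  have hWJ : W * J = 0 := by
    rw [hJ, Matrix.mul_vecMulVec, h_one, Matrix.zero_vecMulVec]
  have hJW : J * W = 0 := by
    rw [hJ, Matrix.vecMulVec_mul, hv, Matrix.vecMulVec_zero]
  have hMJ : M * J = J := by
    calc M * J = M * ((W + J) * J) := by rw [add_mul, hWJ, hJJ, zero_add]
      _ = J := by rw [← mul_assoc, Matrix.nonsing_inv_mul _ hunit, one_mul]
  have hJM : J * M = J := by
    calc J * M = (J * (W + J)) * M := by rw [mul_add, hJW, hJJ, zero_add]
      _ = J := by rw [mul_assoc, Matrix.mul_nonsing_inv _ hunit, mul_one]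
  have hWM : W * M = 1 - J := by
    rw [eq_sub_iff_add_eq]
    conv_lhs => rw [← hJM, ← add_mul]
    exact Matrix.mul_nonsing_inv _ hunit
  have hMW : M * W = 1 - J := by
    rw [eq_sub_iff_add_eq]
    conv_lhs => rw [← hMJ, ← mul_add]
    exact Matrix.nonsing_inv_mul _ hunit
  refine ⟨M - J, ?_, ?_, ?_⟩
  · rw [mul_sub, hWM, hWJ, sub_zero, sub_mul, hJW, one_mul, sub_zero]
  · rw [sub_mul, hMW, hJW, sub_zero, sub_mul, mul_sub, mul_sub, one_mul, hJM, hJJ, sub_self,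
      sub_zero, one_mul]
  · rw [sub_mul, mul_sub, hWM, hMW, hJW, hWJ]

/-- A finite stochastic matrix has no solution of `x - Q x = c e` unless `c = 0`. -/
theorem eq_zero_of_sub_stochastic_mulVec_eq [Nonempty m] {Q : Matrix m m ℝ} (hQ : ∀ i j, 0 ≤ Q i j)
    (h_sum : ∀ i, ∑ j, Q i j = 1) (x : m → ℝ) (c : ℝ) (h : (1 - Q).mulVec x = c • 1) : c = 0 := by
  have h' : ∀ i, x i = c + ∑ j, Q i j * x j := fun i => by
    have := congrFun h i
    rw [Matrix.sub_mulVec, Matrix.one_mulVec] at this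
    simp [Matrix.mulVec, dotProduct] at this
    linarith
  -- Maximum principle: a maximum of `x` yields c ≥ 0, a minimum yields c ≤ 0.
  obtain ⟨a, -, ha⟩ := Finset.exists_max_image Finset.univ x Finset.univ_nonempty
  obtain ⟨b, -, hb⟩ := Finset.exists_min_image Finset.univ x Finset.univ_nonempty
  have h1 : ∑ j, Q a j * x j ≤ x a := by
    calc ∑ j, Q a j * x j ≤ ∑ j, Q a j * x a :=
          Finset.sum_le_sum fun j _ => mul_le_mul_of_nonneg_left (ha j (Finset.mem_univ _)) (hQ _ _)
      _ = x a := by rw [← Finset.sum_mul, h_sum, one_mul]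
  have h2 : x b ≤ ∑ j, Q b j * x j := by
    calc x b = ∑ j, Q b j * x b := by rw [← Finset.sum_mul, h_sum, one_mul]
      _ ≤ ∑ j, Q b j * x j :=
          Finset.sum_le_sum fun j _ => mul_le_mul_of_nonneg_left (hb j (Finset.mem_univ _)) (hQ _ _)
  have := h' a
  have := h' b
  linarith

/-- If a positive function `T` drops by a positive amount under `Q` killed at `a`, then the only
`Q`-harmonic functions of a stochastic matrix `Q` are the constants. -/
theorem eq_const_of_sub_stochastic_mulVec_eq_zero {Q : Matrix m m ℝ} (hQ : ∀ i j, 0 ≤ Q i j)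
    (h_sum : ∀ i, ∑ j, Q i j = 1) (a : m) (T : m → ℝ) (hT0 : ∀ i, 0 < T i)
    (hT : ∀ i, ∑ j, Q i j * (if j = a then 0 else T j) < T i)
    (x : m → ℝ) (h : (1 - Q).mulVec x = 0) : x = x a • 1 := by
  have h' : ∀ i, x i = ∑ j, Q i j * x j := fun i => by
    have := congrFun h i
    rw [Matrix.sub_mulVec, Matrix.one_mulVec] at this
    simp [Matrix.mulVec, dotProduct] at this
    linarith
  set y : m → ℝ := fun i => x i - x a with hy
  have hy' : ∀ i, y i = ∑ j, Q i j * y j := fun i => by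
    simp only [hy, mul_sub, Finset.sum_sub_distrib, ← Finset.sum_mul, h_sum, one_mul]
    rw [← h' i]
  -- The harmonic function `y` vanishes at `a`, so |y| ≤ c T 1_{≠a} with c the largest ratio |y|/T.
  -- At a maximiser the drop of `T` would give |y b| < c T b unless c = 0.
  obtain ⟨b, -, hb⟩ := Finset.exists_max_image Finset.univ (fun i => |y i| / T i) ⟨a, by simp⟩
  set c := |y b| / T b with hc
  have hle : ∀ j, |y j| ≤ c * (if j = a then 0 else T j) := fun j => by
    split_ifs with hj
    · simp [hj, hy]
    · exact (div_le_iff₀ (hT0 j)).1 (hb j (Finset.mem_univ _))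
  have hc0 : 0 ≤ c := div_nonneg (abs_nonneg _) (hT0 b).le
  have hyb : |y b| ≤ c * ∑ j, Q b j * (if j = a then 0 else T j) := by
    rw [hy' b, Finset.mul_sum]
    refine (Finset.abs_sum_le_sum_abs _ _).trans (Finset.sum_le_sum fun j _ => ?_)
    rw [abs_mul, abs_of_nonneg (hQ b j), mul_left_comm]
    exact mul_le_mul_of_nonneg_left (hle j) (hQ b j)
  have hcT : |y b| = c * T b := by rw [hc, div_mul_cancel₀ _ (hT0 b).ne']
  have hc_eq : c = 0 := by
    by_contra hne
    have := mul_lt_mul_of_pos_left (hT b) (lt_of_le_of_ne hc0 (Ne.symm hne))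
    linarith
  funext i
  have := hle i
  rw [hc_eq, zero_mul] at this
  have := abs_nonpos_iff.1 this
  simp only [hy] at this
  simp
  linarith

end GroupInverse

/-! ### Chains killed on a set -/

section Killed

variable {E : Type*} (P : E → PMF E)

/-- The transition matrix with the columns outside of `S` replaced by zero. -/
def restrictColumns (S : Set E) : Matrix E E ℝ≥0∞ :=
  fun i => S.indicator fun j => P i j

/-- The transition matrix of the chain killed when it enters `S`. -/
def killedMatrix (S : Set E) : Matrix E E ℝ≥0∞ :=
  restrictColumns P Sᶜ

theorem rowSum_transitionMatrix (i : E) : rowSum (transitionMatrix P) i = 1 :=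
  (P i).tsum_coe

variable {P}

theorem killedMatrix_of_mem {S : Set E} {j : E} (h : j ∈ S) (i : E) : killedMatrix P S i j = 0 := by
  simp [killedMatrix, restrictColumns, h]

theorem killedMatrix_of_notMem {S : Set E} {j : E} (h : j ∉ S) (i : E) :
    killedMatrix P S i j = P i j := by
  simp [killedMatrix, restrictColumns, h]

variable [DecidableEq E]

/-- The Green matrix of the chain killed on its first return to `S`. -/
def green (P : E → PMF E) (S : Set E) : Matrix E E ℝ≥0∞ :=
  potential (killedMatrix P S)

/-- The killed chain never enters `S` after time 0, so only the initial state can contribute. -/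
theorem green_of_mem {S : Set E} {j : E} (h : j ∈ S) (i : E) :
    green P S i j = (1 : Matrix E E ℝ≥0∞) i j := by
  rw [green, potential_eq_one_add', Matrix.add_apply]
  simp [infMul, killedMatrix_of_mem h]

/-- A set of states which is closed under transitions and not empty contains all states. -/
theorem IsIrreducible.mem_of_closed (hirr : IsIrreducible P) {F : Set E} {i : E} (hi : i ∈ F)
    (hF : ∀ i ∈ F, ∀ j, P i j ≠ 0 → j ∈ F) (j : E) : j ∈ F := by
  have key : ∀ n j, infPow (transitionMatrix P) n i j ≠ 0 → j ∈ F := by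
    intro n
    induction n with
    | zero =>
      intro j hj
      rw [infPow] at hj
      by_cases h : i = j
      · exact h ▸ hi
      · exact absurd (Matrix.one_apply_ne h) hj
    | succ n ih =>
      intro j hj
      rw [infPow] at hj
      simp only [infMul, ne_eq, ENNReal.tsum_eq_zero, not_forall, mul_eq_zero, not_or] at hj
      obtain ⟨r, hr, hrj⟩ := hj
      exact hF r (ih r hr) j hrj
  obtain ⟨n, hn⟩ := hirr i j
  exact key n j hn.ne'

/-- A set of states which is closed under backward transitions and not empty contains all
states. -/
theorem IsIrreducible.mem_of_backward_closed (hirr : IsIrreducible P) {F : Set E} {j : E}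
    (hj : j ∈ F) (hF : ∀ j ∈ F, ∀ i, P i j ≠ 0 → i ∈ F) (i : E) : i ∈ F := by
  by_contra hi
  exact hirr.mem_of_closed (F := Fᶜ) hi (fun r hr s hrs hs => hr (hF s hs r hrs)) j hj

theorem rowSum_green (S : Set E) (i : E) :
    rowSum (green P S) i = 1 + ∑' j, killedMatrix P S i j * rowSum (green P S) j := by
  conv_lhs => rw [green, potential_eq_one_add, rowSum_add, rowSum_one, rowSum_infMul]
  rfl

theorem mul_rowSum_green_le {S : Set E} {j : E} (h : j ∉ S) (i : E) :
    P i j * rowSum (green P S) j ≤ rowSum (green P S) i := by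
  rw [rowSum_green S i, ← killedMatrix_of_notMem h]
  exact (ENNReal.le_tsum (f := fun j => killedMatrix P S i j * rowSum (green P S) j) j).trans
    le_add_self

/-- States with finite mean return time to `a` form a closed set: a jump from i to j ≠ a costs at
least P i j times the mean time from j. -/
theorem rowSum_green_ne_top (hirr : IsIrreducible P) {a : E}
    (h : rowSum (green P {a}) a ≠ ∞) (i : E) : rowSum (green P {a}) i ≠ ∞ := by
  refine hirr.mem_of_closed (F := {i | rowSum (green P {a}) i ≠ ∞}) h (fun r hr s hrs => ?_) i
  by_cases hs : s = a
  · subst hs; exact h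
  · intro htop
    have := mul_rowSum_green_le (P := P) (S := {a}) (j := s) hs r
    rw [htop, ENNReal.mul_top hrs, top_le_iff] at this
    exact hr this

/-- Decomposition of the Green matrix at the first return to a larger set. -/
theorem green_eq_infMul {S S' : Set E} (hS : S ⊆ S') :
    green P S = green P S' +
      infMul (infMul (green P S') (restrictColumns P (S' \ S))) (green P S) := by
  have hsplit : killedMatrix P S =
      restrictColumns P (S' \ S) + killedMatrix P S' := by
    ext i j
    by_cases h : j ∈ S'
    · by_cases h' : j ∈ S <;> simp [killedMatrix, restrictColumns, h, h']
    · have h' : j ∉ S := fun h' => h (hS h')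
      simp [killedMatrix, restrictColumns, h, h']
  -- The chain killed on `S'` is the base chain; jumps into S' ∖ S are the perturbation.
  have := potential_add (restrictColumns P (S' \ S)) (killedMatrix P S')
  rw [← hsplit, infMul_add, infMul_one, ← infMul_assoc] at this
  exact this

theorem green_anti {S S' : Set E} (hS : S ⊆ S') (i j : E) : green P S' i j ≤ green P S i j := by
  conv_rhs => rw [green_eq_infMul hS]
  exact le_self_add

theorem rowSum_green_anti {S S' : Set E} (hS : S ⊆ S') (i : E) :
    rowSum (green P S') i ≤ rowSum (green P S) i :=
  ENNReal.tsum_le_tsum fun _ => green_anti hS _ _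

/-- The law of the first state visited after the start in a set `S`. -/
def hitMatrix (P : E → PMF E) (S : Set E) : Matrix E E ℝ≥0∞ :=
  infMul (green P S) (transitionMatrix P)

theorem infMul_green_restrictColumns (A : Set E) (S : Set E) (i j : E) :
    infMul (green P A) (restrictColumns P S) i j =
      S.indicator (fun j => hitMatrix P A i j) j := by
  by_cases h : j ∈ S <;> simp [infMul, restrictColumns, hitMatrix, h, transitionMatrix]

/-- The Green matrix of the chain killed at `a` in terms of the chain killed on a finite set
containing `a`. -/
theorem green_singleton_eq {A : Finset E} {a : E} (ha : a ∈ A) (i j : E) :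
    green P {a} i j = green P A i j +
      ∑ r : {x // x ∈ A}, hitMatrix P A i r * (if (r : E) = a then 0 else green P {a} r j) := by
  conv_lhs => rw [green_eq_infMul (S := {a}) (S' := A) (by simpa using ha), Matrix.add_apply]
  congr 1
  rw [infMul]
  simp only [infMul_green_restrictColumns]
  rw [tsum_eq_sum (s := A), ← Finset.sum_coe_sort]
  · refine Finset.sum_congr rfl fun r _ => ?_
    by_cases h : (r : E) = a <;> simp [h]
  · intro b hb
    simp [hb]

theorem rowSum_green_singleton_eq {A : Finset E} {a : E} (ha : a ∈ A) (i : E) :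
    rowSum (green P {a}) i = rowSum (green P A) i +
      ∑ r : {x // x ∈ A},
        hitMatrix P A i r * (if (r : E) = a then 0 else rowSum (green P {a}) r) := by
  rw [rowSum]
  simp only [green_singleton_eq ha i]
  rw [ENNReal.tsum_add, Summable.tsum_finsetSum fun _ _ => ENNReal.summable]
  congr 1
  refine Finset.sum_congr rfl fun r _ => ?_
  rw [ENNReal.tsum_mul_left]
  split_ifs <;> simp [rowSum]

/-- The chain enters `A` almost surely. -/
theorem sum_hitMatrix {A : Finset E} {i : E} (h : rowSum (green P A) i ≠ ∞) :
    ∑ r : {x // x ∈ A}, hitMatrix P A i r = 1 := by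
  have hsplit : transitionMatrix P =
      restrictColumns P A + killedMatrix P A := by
    ext i j
    by_cases h : j ∈ A <;> simp [killedMatrix, restrictColumns, h, transitionMatrix]
  -- The mass of G_A P is computed twice: as G_A e, because P e = e, and by splitting the columns of
  -- P. The common term is finite and cancels.
  have h1 : rowSum (green P A) i = rowSum (hitMatrix P A) i := by
    rw [hitMatrix, rowSum_infMul]
    simp only [rowSum_transitionMatrix, mul_one]
    rfl
  have h2 : rowSum (green P A) i = 1 + rowSum (infMul (green P A) (killedMatrix P A)) i := by
    conv_lhs => rw [green, potential_eq_one_add', rowSum_add, rowSum_one]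
    rfl
  have h3 : rowSum (hitMatrix P A) i = ∑ r : {x // x ∈ A}, hitMatrix P A i r +
      rowSum (infMul (green P A) (killedMatrix P A)) i := by
    conv_lhs => rw [hitMatrix, hsplit, infMul_add, rowSum_add]
    congr 1
    rw [rowSum]
    simp only [infMul_green_restrictColumns]
    rw [tsum_eq_sum (s := A), ← Finset.sum_coe_sort]
    · exact Finset.sum_congr rfl fun r _ => by simp
    · intro b hb
      simp [hb]
  have hfin : rowSum (infMul (green P A) (killedMatrix P A)) i ≠ ∞ := by
    intro htop
    rw [htop] at h2
    exact h (by rw [h2]; simp)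
  have : ∑ r : {x // x ∈ A}, hitMatrix P A i r + rowSum (infMul (green P A) (killedMatrix P A)) i =
      1 + rowSum (infMul (green P A) (killedMatrix P A)) i := by rw [← h3, ← h1, h2]
  exact (ENNReal.add_left_inj hfin).1 this

/-! ### The cycle formula for the invariant vector -/

/-- By minimality, p dominates the measure p(a) G_a(a, ·). The difference is a nonnegative invariant
vector that vanishes at `a`; its zero set is closed under backward transitions, hence is everything.
-/
theorem mul_green_eq (hirr : IsIrreducible P) {p : PMF E} (hp : IsInvariant P p) (a j : E) :
    p a * green P {a} a j = p j := by
  -- The row vector p(a) δ_a, as a one-row matrix.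
  set F : Matrix Unit E ℝ≥0∞ := fun _ i => p a * (1 : Matrix E E ℝ≥0∞) a i with hF
  have hFM : ∀ (M : Matrix E E ℝ≥0∞) (j : E), infMul F M () j = p a * M a j := fun M j => by
    simp only [infMul, hF, mul_assoc, ENNReal.tsum_mul_left]
    congr 1
    exact congrFun (congrFun (one_infMul M) a) j
  set g : E → ℝ≥0∞ := fun j => p a * green P {a} a j with hg
  have hga : g a = p a := by
    simp only [hg]
    rw [green_of_mem (Set.mem_singleton a)]
    simp
  have hinv : ∀ j, j ≠ a → ∑' i, p i * killedMatrix P {a} i j = p j := fun j hj => by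
    rw [← hp j]
    exact tsum_congr fun i => by rw [killedMatrix_of_notMem (S := {a}) hj]
  have hle : ∀ j, g j ≤ p j := fun j => by
    have := infMul_potential_le (M := killedMatrix P {a}) (F := F)
      (Y := fun _ i => p i) (fun _ j => ?_) () j
    · rwa [hFM] at this
    · by_cases hj : j = a
      · subst hj
        simp [infMul, hF, killedMatrix_of_mem]
      · simp only [infMul, hF, Matrix.one_apply_ne (Ne.symm hj)]
        rw [hinv j hj]
        simp
  have hgeq : ∀ j, j ≠ a → g j = ∑' i, g i * P i j := fun j hj => by
    simp only [hg]
    conv_lhs => rw [green, potential_eq_one_add', Matrix.add_apply,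
      Matrix.one_apply_ne (Ne.symm hj), zero_add]
    simp only [infMul, ← ENNReal.tsum_mul_left, mul_assoc]
    exact tsum_congr fun i => by rw [killedMatrix_of_notMem (S := {a}) hj]; rfl
  -- the difference of the two vectors is invariant and vanishes at `a`
  set d : E → ℝ≥0∞ := fun j => p j - g j with hd
  have hdp : ∀ j, g j + d j = p j := fun j => add_tsub_cancel_of_le (hle j)
  have hda : d a = 0 := by simp [hd, hga]
  have hg_ne : ∀ j, g j ≠ ∞ := fun j => ne_top_of_le_ne_top (p.apply_ne_top j) (hle j)
  have hdinv : ∀ j, j ≠ a → ∑' i, d i * P i j = d j := fun j hj => by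
    have : g j + ∑' i, d i * P i j = g j + d j := by
      rw [hdp, ← hp j]
      conv_lhs => rw [hgeq j hj, ← ENNReal.tsum_add]
      exact tsum_congr fun i => by rw [← add_mul, hdp]
    exact (ENNReal.add_right_inj (hg_ne j)).1 this
  have hdsum : ∑' j, d j ≠ ∞ :=
    ne_top_of_le_ne_top (by rw [p.tsum_coe]; exact ENNReal.one_ne_top)
      (ENNReal.tsum_le_tsum fun j => (tsub_le_self : p j - g j ≤ p j))
  have htot : ∑' j, ∑' i, d i * P i j = ∑' j, d j := by
    rw [ENNReal.tsum_comm]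
    simp only [ENNReal.tsum_mul_left, PMF.tsum_coe, mul_one]
  -- The killed matrix has column `a` equal to zero and gives no information there. Invariance at
  -- `a` follows from conservation of total mass, the other coordinates being already invariant with
  -- finite sum.
  have hda' : ∑' i, d i * P i a = 0 := by
    rw [ENNReal.tsum_eq_add_tsum_ite a, ENNReal.tsum_eq_add_tsum_ite (f := d) a, hda] at htot
    have : ∑' x, (if x = a then 0 else ∑' i, d i * P i x) = ∑' x, (if x = a then 0 else d x) :=
      tsum_congr fun x => by
        split_ifs with h
        · rfl
        · exact hdinv x h
    have htot' : ∑' i, d i * P i a + ∑' x, (if x = a then 0 else ∑' i, d i * P i x) =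
        0 + ∑' x, (if x = a then 0 else d x) := by convert htot
    rw [this] at htot'
    refine (ENNReal.add_left_inj ?_).1 htot'
    refine ne_top_of_le_ne_top hdsum (ENNReal.tsum_le_tsum fun x => ?_)
    split_ifs <;> simp
  have hd0 : d j = 0 :=
    hirr.mem_of_backward_closed (F := {j | d j = 0}) hda (fun j hj i hij => by
      have hsum : ∑' i, d i * P i j = 0 := by
        by_cases h : j = a
        · rw [h]; exact hda'
        · rw [hdinv j h]; exact hj
      exact (mul_eq_zero.1 (ENNReal.tsum_eq_zero.1 hsum i)).resolve_right hij) j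
  have := hdp j
  rwa [hd0, add_zero] at this

/-- The cycle formula: the expected number of visits to `j` in a cycle is the product of `p j` and
the mean cycle length. -/
theorem green_self_eq (hirr : IsIrreducible P) {p : PMF E} (hp : IsInvariant P p) (a j : E) :
    green P {a} a j = p j * rowSum (green P {a}) a := by
  have h1 : p a * rowSum (green P {a}) a = 1 := by
    rw [rowSum, ← ENNReal.tsum_mul_left]
    simp only [mul_green_eq hirr hp a, p.tsum_coe]
  rw [← mul_green_eq hirr hp a j, mul_right_comm, h1, one_mul]

end Killed

/-! ### The blocks as parts of the Green matrix -/

section Blocks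

variable {E : Type*} (P : E → PMF E) (A : Finset E)

theorem tsum_eq_tsum_notMem {f : E → ℝ≥0∞} (h : ∀ r ∈ A, f r = 0) :
    ∑' r, f r = ∑' r : {x // x ∉ A}, f r :=
  (tsum_subtype_eq_of_support_subset (s := {x | x ∉ A}) fun r hr hA => hr (h r hA)).symm

theorem tsum_eq_sum_add_tsum (f : E → ℝ≥0∞) :
    ∑' r, f r = ∑ r : {x // x ∈ A}, f r + ∑' r : {x // x ∉ A}, f r := by
  rw [← tsum_fintype (L := SummationFilter.unconditional _)]
  exact (ENNReal.summable.tsum_add_tsum_compl (s := (A : Set E)) ENNReal.summable).symm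

variable [DecidableEq E]

theorem infPow_killedMatrix (k : ℕ) (i j : {x // x ∉ A}) :
    infPow (killedMatrix P A) k i j = infPow (blockBB P A) k i j := by
  induction k generalizing j with
  | zero => simp [infPow, Matrix.one_apply, Subtype.ext_iff]
  | succ k ih =>
    simp only [infPow, infMul]
    rw [tsum_eq_tsum_notMem A fun r hr => ?_]
    · refine tsum_congr fun r => ?_
      rw [ih, killedMatrix_of_notMem (by simpa using j.2)]
      rfl
    -- A state r in `A` carries no weight: at time 0 the start lies outside `A`, later the chain
    -- would have been killed.
    · rcases k with _ | k
      · rw [infPow, Matrix.one_apply_ne (fun h => i.2 (by rw [h]; exact hr)), zero_mul]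
      · simp [infPow, infMul, killedMatrix_of_mem (P := P) (S := (A : Set E)) hr]

theorem hatBB_eq (i j : {x // x ∉ A}) : hatBB P A i j = green P A i j :=
  tsum_congr fun k => (infPow_killedMatrix P A k i j).symm

theorem green_eq_of_notMem (i : E) (j : {x // x ∉ A}) :
    green P A i j = (1 : Matrix E E ℝ≥0∞) i j + ∑' r : {x // x ∉ A}, P i r * hatBB P A r j := by
  conv_lhs => rw [green, potential_eq_one_add, Matrix.add_apply]
  congr 1
  rw [infMul, tsum_eq_tsum_notMem A fun r hr => ?_]
  · refine tsum_congr fun r => ?_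
    rw [killedMatrix_of_notMem (by simpa using r.2), hatBB_eq]
    rfl
  · rw [killedMatrix_of_mem (by simpa using hr), zero_mul]

theorem hatAB_eq (i : {x // x ∈ A}) (j : {x // x ∉ A}) : hatAB P A i j = green P A i j := by
  rw [green_eq_of_notMem, Matrix.one_apply_ne (fun h => j.2 (by rw [← h]; exact i.2)), zero_add]
  rfl

theorem sum_one_apply (i : {x // x ∈ A}) (f : E → ℝ≥0∞) :
    ∑ r : {x // x ∈ A}, (1 : Matrix E E ℝ≥0∞) i r * f r = f i := by
  rw [Finset.sum_eq_single i (fun b _ hb => ?_) (by simp)]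
  · simp
  · rw [Matrix.one_apply_ne (fun h => hb (Subtype.ext h.symm)), zero_mul]

theorem hitMatrix_of_mem (i : {x // x ∈ A}) (j : E) :
    hitMatrix P A i j = P i j + ∑' r : {x // x ∉ A}, hatAB P A i r * P r j := by
  rw [hitMatrix, infMul, tsum_eq_sum_add_tsum A]
  simp only [← hatAB_eq]
  congr 1
  refine Eq.trans (Finset.sum_congr rfl fun r _ => ?_) (sum_one_apply A i fun r => P r j)
  rw [green_of_mem (by simp)]
  rfl

theorem hitMatrix_of_notMem (i : {x // x ∉ A}) (j : E) :
    hitMatrix P A i j = ∑' r : {x // x ∉ A}, hatBB P A i r * P r j := by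
  rw [hitMatrix, infMul, tsum_eq_tsum_notMem A]
  · simp only [← hatBB_eq]
    rfl
  · intro r hr
    rw [green_of_mem (by simpa using hr), Matrix.one_apply_ne (fun h => i.2 (by rw [h]; exact hr)),
      zero_mul]

theorem rowSum_hatBB_eq (i : {x // x ∉ A}) : rowSum (hatBB P A) i = rowSum (green P A) i := by
  rw [rowSum, rowSum, tsum_eq_tsum_notMem A]
  · simp only [hatBB_eq]
  · intro r hr
    rw [green_of_mem (by simpa using hr), Matrix.one_apply_ne (fun h => i.2 (by rw [h]; exact hr))]

/-- The summand `1` is the visit at time 0, the only one to `A` before the return. Thus e + P_AB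
P̂_BB e is the mean return time to `A`. -/
theorem rowSum_hatAB_eq (i : {x // x ∈ A}) : 1 + rowSum (hatAB P A) i = rowSum (green P A) i := by
  rw [rowSum, rowSum, tsum_eq_sum_add_tsum A]
  simp only [hatAB_eq]
  congr 1
  refine ((sum_one_apply A i fun _ => 1).symm.trans (Finset.sum_congr rfl fun r _ => ?_))
  rw [green_of_mem (by simp), mul_one]

end Blocks

/-! ### Laws of the killed chain -/

section Chain

variable {E Ω : Type*}

theorem lt_returnTime_iff {Φ : ℕ → Ω → E} {S : Set E} {ω : Ω} {n : ℕ} :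
    (n : ℕ∞) < returnTime Φ S ω ↔ ∀ k, 1 ≤ k → k ≤ n → Φ k ω ∉ S := by
  rw [← not_le]
  have : returnTime Φ S ω ≤ (n : ℕ∞) ↔ ∃ j ∈ Set.Icc 1 n, Φ j ω ∈ S := hittingAfter_le_iff
  rw [this]
  simp only [Set.mem_Icc, not_exists, not_and, and_imp]

theorem returnTime_eq_iff {Φ : ℕ → Ω → E} {S : Set E} {ω : Ω} {n : ℕ} :
    returnTime Φ S ω = (n + 1 : ℕ) ↔ (n : ℕ∞) < returnTime Φ S ω ∧ Φ (n + 1) ω ∈ S := by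
  have h1 : (n : ℕ∞) < returnTime Φ S ω ↔ ((n + 1 : ℕ) : ℕ∞) ≤ returnTime Φ S ω := by
    rw [Nat.cast_succ, ENat.add_one_le_iff (ENat.natCast_ne_top n)]
  constructor
  · intro h
    have hn : (n : ℕ∞) < returnTime Φ S ω := h1.2 h.ge
    refine ⟨hn, ?_⟩
    by_contra hS
    have : ((n + 1 : ℕ) : ℕ∞) < returnTime Φ S ω := lt_returnTime_iff.2 fun k hk hkn => by
      rcases Nat.lt_or_ge n k with hlt | hge
      · rwa [show k = n + 1 by omega]
      · exact lt_returnTime_iff.1 hn k hk hge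
    exact this.ne h.symm
  · rintro ⟨hn, hS⟩
    refine le_antisymm (not_lt.1 fun h => ?_) (h1.1 hn)
    exact lt_returnTime_iff.1 h (n + 1) (by omega) le_rfl hS

/-! ### Numbers of visits before the return -/

/-- The number of visits to `j` before the return to `S`. -/
def visits (Φ : ℕ → Ω → E) (S : Set E) (j : E) (ω : Ω) : ℝ≥0∞ :=
  ∑' k : ℕ, {ω | (k : ℕ∞) < returnTime Φ S ω ∧ Φ k ω = j}.indicator 1 ω

/-- Each time k < τ_S is spent in exactly one state; this holds also where τ_S is infinite. -/
theorem tsum_visits (Φ : ℕ → Ω → E) (S : Set E) (ω : Ω) :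
    ∑' j, visits Φ S j ω = (returnTime Φ S ω : ℝ≥0∞) := by
  unfold visits
  rw [ENNReal.tsum_comm]
  have : ∀ k : ℕ, ∑' j, {ω | (k : ℕ∞) < returnTime Φ S ω ∧ Φ k ω = j}.indicator
      (1 : Ω → ℝ≥0∞) ω = if (k : ℕ∞) < returnTime Φ S ω then 1 else 0 := fun k => by
    rw [tsum_eq_single (Φ k ω) fun j hj => by simp [hj.symm]]
    simp [Set.indicator]
  simp only [this]
  rcases eq_or_ne (returnTime Φ S ω) ⊤ with h | h
  · simp [h]
  · obtain ⟨m, hm⟩ := ENat.ne_top_iff_exists.1 h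
    rw [← hm, tsum_eq_sum (s := Finset.range m)]
    · rw [Finset.sum_congr rfl fun k hk => if_pos (by exact_mod_cast Finset.mem_range.1 hk)]
      simp
    · intro k hk
      rw [if_neg (by simpa using hk)]

/-- Finiteness matters because `toNat` sends `⊤` to 0, which would make the left side an empty sum.
-/
theorem additiveFunctional_eq [DecidableEq E] (p : PMF E) (Φ : ℕ → Ω → E) (a j : E) {ω : Ω}
    (h : returnTime Φ {a} ω ≠ ⊤) :
    additiveFunctional p Φ a j ω =
      (visits Φ {a} j ω).toReal - (returnTime Φ {a} ω : ℝ≥0∞).toReal * (p j).toReal := by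
  obtain ⟨m, hm⟩ := ENat.ne_top_iff_exists.1 h
  have hv : visits Φ {a} j ω = ∑ k ∈ Finset.range m, if Φ k ω = j then 1 else 0 := by
    rw [visits, tsum_eq_sum (s := Finset.range m)]
    · refine Finset.sum_congr rfl fun k hk => ?_
      have : (k : ℕ∞) < returnTime Φ {a} ω := by
        rw [← hm]
        exact_mod_cast Finset.mem_range.1 hk
      simp [Set.indicator, this]
    · intro k hk
      have : ¬ (k : ℕ∞) < returnTime Φ {a} ω := by
        rw [← hm]
        simpa using hk
      simp [this]
  rw [additiveFunctional, hv, ← hm, Finset.sum_sub_distrib, ENNReal.toReal_sum]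
  · congr 1
    · exact Finset.sum_congr rfl fun k _ => by split_ifs <;> simp
    · simp
  · intro k _
    split_ifs <;> simp

/-! ### The Markov property at return times -/

variable [MeasurableSpace Ω]

theorem measure_eq_tsum_inter_fiber {F : Type*} [Countable F] (ν : Measure Ω) (f : Ω → F)
    (hf : ∀ y, MeasurableSet (f ⁻¹' {y})) {T : Set Ω} (hT : MeasurableSet T) :
    ν T = ∑' y, ν (T ∩ f ⁻¹' {y}) := by
  rw [← measure_iUnion _ fun y => hT.inter (hf y)]
  · congr 1
    ext ω
    simp
  · intro y z hyz
    refine Set.disjoint_left.2 fun ω hy hz => hyz ?_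
    exact (hy.2 : f ω = y).symm.trans hz.2

variable [Countable E] [MeasurableSpace E] [MeasurableSingletonClass E]
  {P : E → PMF E} {μ : E → Measure Ω} {Φ : ℕ → Ω → E}

theorem IsMarkovChain.measurableSet_mem (hΦ : IsMarkovChain P μ Φ) (n : ℕ) (S : Set E) :
    MeasurableSet {ω | Φ n ω ∈ S} :=
  hΦ.measurable n (.of_discrete (s := S))

theorem IsMarkovChain.measurableSet_eq (hΦ : IsMarkovChain P μ Φ) (n : ℕ) (j : E) :
    MeasurableSet {ω | Φ n ω = j} :=
  hΦ.measurableSet_mem n {j}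

theorem IsMarkovChain.measurableSet_lt_returnTime (hΦ : IsMarkovChain P μ Φ) (n : ℕ) (S : Set E) :
    MeasurableSet {ω | (n : ℕ∞) < returnTime Φ S ω} := by
  simp only [lt_returnTime_iff, Set.ofPred_forall]
  exact .iInter fun k => .iInter fun _ => .iInter fun _ => (hΦ.measurableSet_mem k S).compl

/-- The Markov property for the events `n < τ_S`. -/
theorem IsMarkovChain.measure_lt_returnTime_succ (hΦ : IsMarkovChain P μ Φ) (S : Set E) (n : ℕ)
    (i j : E) :
    μ i {ω | (n : ℕ∞) < returnTime Φ S ω ∧ Φ (n + 1) ω = j} =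
      ∑' r, μ i {ω | (n : ℕ∞) < returnTime Φ S ω ∧ Φ n ω = r} * P r j := by
  have hS := hΦ.measurableSet_lt_returnTime n S
  change μ i ({ω | (n : ℕ∞) < returnTime Φ S ω} ∩ {ω | Φ (n + 1) ω = j}) =
    ∑' r, μ i ({ω | (n : ℕ∞) < returnTime Φ S ω} ∩ {ω | Φ n ω = r}) * P r j
  rw [measure_eq_tsum_inter_fiber (μ i) (Φ n) (hΦ.measurableSet_eq n)
    (hS.inter (hΦ.measurableSet_eq (n + 1) j))]
  refine tsum_congr fun r => ?_
  change μ i ({ω | (n : ℕ∞) < returnTime Φ S ω} ∩ {ω | Φ (n + 1) ω = j} ∩ {ω | Φ n ω = r}) = _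
  -- The Markov property is assumed for complete paths only, so the event is split over the
  -- countably many paths on 0, …, n.
  set h : Ω → Fin (n + 1) → E := fun ω k => Φ k ω with hh
  have hfib : ∀ x : Fin (n + 1) → E, h ⁻¹' {x} = {ω | ∀ k : Fin (n + 1), Φ k ω = x k} := fun x => by
    ext ω
    simp [hh, funext_iff]
  have hmeas : ∀ x, MeasurableSet (h ⁻¹' {x}) := fun x => by
    rw [hfib, Set.ofPred_forall]
    exact .iInter fun k => hΦ.measurableSet_eq k (x k)
  rw [measure_eq_tsum_inter_fiber (μ i) h hmeas
      ((hS.inter (hΦ.measurableSet_eq (n + 1) j)).inter (hΦ.measurableSet_eq n r)),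
    measure_eq_tsum_inter_fiber (μ i) h hmeas (hS.inter (hΦ.measurableSet_eq n r)),
    ← ENNReal.tsum_mul_right]
  refine tsum_congr fun x => ?_
  -- The path decides survival and the state at time n: its fibre lies inside the event {n < τ_S,
  -- Φ_n = r} or misses it.
  by_cases hx : (∀ k : Fin (n + 1), 1 ≤ (k : ℕ) → x k ∉ S) ∧ x (Fin.last n) = r
  · have hsurv : ∀ ω, h ω = x → (n : ℕ∞) < returnTime Φ S ω ∧ Φ n ω = r := fun ω hω => by
      subst hω
      exact ⟨lt_returnTime_iff.2 fun k hk hkn => hx.1 ⟨k, by omega⟩ hk, hx.2⟩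
    set y : ℕ → E := fun k => if hk : k < n + 1 then x ⟨k, hk⟩ else j with hy
    have hmk := hΦ.markov i n y
    have hyn : y n = r := by simp only [hy, dif_pos (Nat.lt_succ_self n)]; exact hx.2
    have hyn1 : y (n + 1) = j := by simp [hy]
    have hhx : ∀ ω, h ω = x ↔ ∀ k ≤ n, Φ k ω = y k := fun ω => by
      constructor
      · intro hω k hk
        simp only [hy, dif_pos (Nat.lt_succ_of_le hk), ← hω, hh]
      · intro hω
        funext k
        have := hω k (Nat.le_of_lt_succ k.2)
        simpa [hy, hh, Nat.le_of_lt_succ k.2] using this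
    rw [hyn, hyn1] at hmk
    convert hmk using 2
    · ext ω
      constructor
      · rintro ⟨⟨⟨-, hj⟩, -⟩, hω⟩ k hk
        rcases Nat.lt_or_ge n k with hlt | hge
        · rw [show k = n + 1 by omega, hyn1]; exact hj
        · exact (hhx ω).1 hω k hge
      · intro hω
        have hx' := (hhx ω).2 fun k hk => hω k (by omega)
        exact ⟨⟨⟨(hsurv ω hx').1, (hω (n + 1) le_rfl).trans hyn1⟩, (hsurv ω hx').2⟩, hx'⟩
    · congr 1
      ext ω
      exact ⟨fun hω => (hhx ω).1 hω.2, fun hω => ⟨hsurv ω ((hhx ω).2 hω), (hhx ω).2 hω⟩⟩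
  · have hnone : ∀ ω, h ω = x → (n : ℕ∞) < returnTime Φ S ω → Φ n ω ≠ r := fun ω hω hn hr => by
      subst hω
      exact hx ⟨fun k hk => lt_returnTime_iff.1 hn k hk (Nat.le_of_lt_succ k.2), hr⟩
    have h1 : ({ω | (n : ℕ∞) < returnTime Φ S ω} ∩ {ω | Φ (n + 1) ω = j} ∩ {ω | Φ n ω = r}) ∩
        h ⁻¹' {x} = ∅ :=
      Set.eq_empty_of_forall_notMem fun ω hω => hnone ω hω.2 hω.1.1.1 hω.1.2
    have h2 : ({ω | (n : ℕ∞) < returnTime Φ S ω} ∩ {ω | Φ n ω = r}) ∩ h ⁻¹' {x} = ∅ :=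
      Set.eq_empty_of_forall_notMem fun ω hω => hnone ω hω.2 hω.1.1 hω.1.2
    rw [h1, h2]
    simp

theorem IsMarkovChain.measurable_visits (hΦ : IsMarkovChain P μ Φ) (S : Set E) (j : E) :
    Measurable (visits Φ S j) :=
  .tsum fun k => measurable_one.indicator
    ((hΦ.measurableSet_lt_returnTime k S).inter (hΦ.measurableSet_eq k j))

theorem IsMarkovChain.measurable_returnTime (hΦ : IsMarkovChain P μ Φ) (S : Set E) :
    Measurable fun ω => (returnTime Φ S ω : ℝ≥0∞) := by
  simp only [← tsum_visits]
  exact .tsum fun j => hΦ.measurable_visits S j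

variable [DecidableEq E]

theorem IsMarkovChain.measure_lt_returnTime (hΦ : IsMarkovChain P μ Φ) (S : Set E) (n : ℕ)
    (i j : E) :
    μ i {ω | (n : ℕ∞) < returnTime Φ S ω ∧ Φ n ω = j} = infPow (killedMatrix P S) n i j := by
  induction n generalizing j with
  | zero =>
    have := hΦ.isProbabilityMeasure i
    have h0 : ∀ᵐ ω ∂(μ i), ((0 : ℕ) : ℕ∞) < returnTime Φ S ω ∧ Φ 0 ω = i := by
      filter_upwards [hΦ.start i] with ω hω
      exact ⟨lt_returnTime_iff.2 fun k hk hk0 => by omega, hω⟩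
    rw [infPow]
    by_cases hij : i = j
    · subst hij
      rw [Matrix.one_apply_eq, ← measure_univ (μ := μ i)]
      refine measure_congr ?_
      filter_upwards [h0] with ω hω
      exact propext ⟨fun _ => trivial, fun _ => hω⟩
    · rw [Matrix.one_apply_ne hij]
      refine measure_mono_null ?_ (ae_iff.1 h0)
      rintro ω ⟨-, hω⟩ ⟨-, hω'⟩
      exact hij (hω'.symm.trans hω)
  | succ n ih =>
    rw [infPow, infMul]
    -- Arrival in `S` at time n + 1 is excluded by survival; for j outside `S`, survival up to n
    -- already gives survival up to n + 1.
    by_cases hj : j ∈ S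
    · simp only [killedMatrix_of_mem hj, mul_zero, tsum_zero]
      rw [← measure_empty (μ := μ i)]
      congr 1
      refine Set.eq_empty_of_forall_notMem fun ω hω => ?_
      exact lt_returnTime_iff.1 hω.1 (n + 1) (by omega) le_rfl (by rw [hω.2]; exact hj)
    · have hset : {ω | ((n + 1 : ℕ) : ℕ∞) < returnTime Φ S ω ∧ Φ (n + 1) ω = j} =
          {ω | (n : ℕ∞) < returnTime Φ S ω ∧ Φ (n + 1) ω = j} := by
        ext ω
        refine and_congr_left fun hω => ?_
        simp only [lt_returnTime_iff]
        refine ⟨fun h k hk hkn => h k hk (by omega), fun h k hk hkn => ?_⟩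
        rcases Nat.lt_or_ge n k with hlt | hge
        · rw [show k = n + 1 by omega, hω]; exact hj
        · exact h k hk hge
      rw [hset, hΦ.measure_lt_returnTime_succ]
      exact tsum_congr fun r => by rw [ih, killedMatrix_of_notMem hj]

/-- The law of the chain at its return to `S`. -/
theorem IsMarkovChain.measure_returnTime (hΦ : IsMarkovChain P μ Φ) {S : Set E} (i : E) {j : E}
    (hj : j ∈ S) :
    μ i {ω | returnTime Φ S ω ≠ ⊤ ∧ Φ (returnTime Φ S ω).toNat ω = j} = hitMatrix P S i j := by
  -- The event is split according to the value n + 1 of the return time, which is never 0.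
  have hset : {ω | returnTime Φ S ω ≠ ⊤ ∧ Φ (returnTime Φ S ω).toNat ω = j} =
      ⋃ n : ℕ, {ω | (n : ℕ∞) < returnTime Φ S ω ∧ Φ (n + 1) ω = j} := by
    ext ω
    simp only [Set.mem_iUnion]
    constructor
    · rintro ⟨htop, hω⟩
      obtain ⟨m, hm⟩ := ENat.ne_top_iff_exists.1 htop
      have hpos : ((0 : ℕ) : ℕ∞) < returnTime Φ S ω :=
        lt_returnTime_iff.2 fun k hk hk0 => by omega
      rw [← hm, Nat.cast_lt] at hpos
      obtain ⟨n, rfl⟩ := Nat.exists_eq_succ_of_ne_zero hpos.ne'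
      rw [← hm, ENat.toNat_natCast] at hω
      exact ⟨n, by rw [← hm]; exact_mod_cast Nat.lt_succ_self n, hω⟩
    · rintro ⟨n, hn, hω⟩
      have := returnTime_eq_iff.2 ⟨hn, by rw [hω]; exact hj⟩
      refine ⟨by rw [this]; exact ENat.natCast_ne_top _, ?_⟩
      rw [this, ENat.toNat_natCast]
      exact hω
  rw [hset, measure_iUnion]
  · simp only [hΦ.measure_lt_returnTime_succ, hΦ.measure_lt_returnTime]
    rw [hitMatrix, green, potential_infMul_apply]
    rfl
  · intro m n hmn
    refine Set.disjoint_left.2 fun ω hm hn => hmn ?_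
    have h1 := returnTime_eq_iff.2 ⟨hm.1, by rw [hm.2]; exact hj⟩
    have h2 := returnTime_eq_iff.2 ⟨hn.1, by rw [hn.2]; exact hj⟩
    have := h1.symm.trans h2
    have := Nat.cast_injective this
    omega
  · exact fun n =>
      (hΦ.measurableSet_lt_returnTime n S).inter (hΦ.measurableSet_eq (n + 1) j)

theorem IsMarkovChain.lintegral_visits (hΦ : IsMarkovChain P μ Φ) (S : Set E) (i j : E) :
    ∫⁻ ω, visits Φ S j ω ∂(μ i) = green P S i j := by
  have hm : ∀ k : ℕ, MeasurableSet {ω | (k : ℕ∞) < returnTime Φ S ω ∧ Φ k ω = j} := fun k =>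
    (hΦ.measurableSet_lt_returnTime k S).inter (hΦ.measurableSet_eq k j)
  unfold visits
  rw [lintegral_tsum fun k => (measurable_one.indicator (hm k)).aemeasurable]
  refine tsum_congr fun k => ?_
  rw [← hΦ.measure_lt_returnTime]
  exact lintegral_indicator_one (hm k)

theorem IsMarkovChain.lintegral_returnTime (hΦ : IsMarkovChain P μ Φ) (S : Set E) (i : E) :
    ∫⁻ ω, (returnTime Φ S ω : ℝ≥0∞) ∂(μ i) = rowSum (green P S) i := by
  simp only [← tsum_visits]
  rw [lintegral_tsum fun j => (hΦ.measurable_visits S j).aemeasurable]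
  exact tsum_congr fun j => hΦ.lintegral_visits S i j

theorem IsMarkovChain.ae_returnTime_ne_top (hΦ : IsMarkovChain P μ Φ) {a i : E}
    (hfin : rowSum (green P {a}) i ≠ ∞) : ∀ᵐ ω ∂(μ i), returnTime Φ {a} ω ≠ ⊤ := by
  rw [← hΦ.lintegral_returnTime] at hfin
  filter_upwards [ae_lt_top (hΦ.measurable_returnTime {a}) hfin] with ω hω h
  simp [h] at hω

theorem IsMarkovChain.integrable_visits (hΦ : IsMarkovChain P μ Φ) {a i : E}
    (hfin : rowSum (green P {a}) i ≠ ∞) (j : E) :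
    Integrable (fun ω => (visits Φ {a} j ω).toReal) (μ i) :=
  integrable_toReal_of_lintegral_ne_top (hΦ.measurable_visits _ _).aemeasurable
    (by rw [hΦ.lintegral_visits]; exact ne_top_of_le_ne_top hfin (apply_le_rowSum _ _ _))

theorem IsMarkovChain.integrable_returnTime (hΦ : IsMarkovChain P μ Φ) {a i : E}
    (hfin : rowSum (green P {a}) i ≠ ∞) :
    Integrable (fun ω => (returnTime Φ {a} ω : ℝ≥0∞).toReal) (μ i) :=
  integrable_toReal_of_lintegral_ne_top (hΦ.measurable_returnTime _).aemeasurable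
    (by rwa [hΦ.lintegral_returnTime])

theorem IsMarkovChain.integrable_additiveFunctional (hΦ : IsMarkovChain P μ Φ) {a i : E}
    (hfin : rowSum (green P {a}) i ≠ ∞) (p : PMF E) (j : E) :
    Integrable (additiveFunctional p Φ a j) (μ i) := by
  refine ((hΦ.integrable_visits hfin j).sub
    ((hΦ.integrable_returnTime hfin).mul_const (p j).toReal)).congr ?_
  filter_upwards [hΦ.ae_returnTime_ne_top hfin] with ω hω
  exact (additiveFunctional_eq p Φ a j hω).symm

theorem IsMarkovChain.additiveMatrix_eq (hΦ : IsMarkovChain P μ Φ) {a i : E}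
    (hfin : rowSum (green P {a}) i ≠ ∞) (p : PMF E) (j : E) :
    additiveMatrix p μ Φ a i j =
      (green P {a} i j).toReal - (rowSum (green P {a}) i).toReal * (p j).toReal := by
  have hae : additiveFunctional p Φ a j =ᵐ[μ i] fun ω =>
      (visits Φ {a} j ω).toReal - (returnTime Φ {a} ω : ℝ≥0∞).toReal * (p j).toReal := by
    filter_upwards [hΦ.ae_returnTime_ne_top hfin] with ω hω
    exact additiveFunctional_eq p Φ a j hω
  rw [additiveMatrix, integral_congr_ae hae, integral_sub (hΦ.integrable_visits hfin j)
    ((hΦ.integrable_returnTime hfin).mul_const _), integral_mul_const,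
    integral_toReal (hΦ.measurable_visits _ _).aemeasurable,
    integral_toReal (hΦ.measurable_returnTime _).aemeasurable, hΦ.lintegral_visits,
    hΦ.lintegral_returnTime]
  · exact ae_lt_top (hΦ.measurable_returnTime _) (by rwa [hΦ.lintegral_returnTime])
  · exact ae_lt_top (hΦ.measurable_visits _ _)
      (by rw [hΦ.lintegral_visits]; exact ne_top_of_le_ne_top hfin (apply_le_rowSum _ _ _))

end Chain

/-! ### The censored chain and the additive matrix -/

section Censored

variable {E : Type*} [DecidableEq E] {P : E → PMF E} {A : Finset E} {a : E}

theorem rowSum_green_finset_ne_top (hfin : ∀ i, rowSum (green P {a}) i ≠ ∞) (ha : a ∈ A) (i : E) :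
    rowSum (green P A) i ≠ ∞ :=
  ne_top_of_le_ne_top (hfin i) (rowSum_green_anti (by simpa using ha) i)

theorem rowSum_hatBB_ne_top (hfin : ∀ i, rowSum (green P {a}) i ≠ ∞) (ha : a ∈ A)
    (i : {x // x ∉ A}) : rowSum (hatBB P A) i ≠ ∞ := by
  rw [rowSum_hatBB_eq]
  exact rowSum_green_finset_ne_top hfin ha i

theorem rowSum_hatAB_ne_top (hfin : ∀ i, rowSum (green P {a}) i ≠ ∞) (ha : a ∈ A)
    (i : {x // x ∈ A}) : rowSum (hatAB P A) i ≠ ∞ := by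
  refine ne_top_of_le_ne_top (rowSum_green_finset_ne_top hfin ha i) ?_
  rw [← rowSum_hatAB_eq]
  exact le_add_self

theorem hitMatrix_ne_top (hfin : ∀ i, rowSum (green P {a}) i ≠ ∞) (ha : a ∈ A) (i : E)
    (r : {x // x ∈ A}) : hitMatrix P A i r ≠ ∞ := by
  refine ne_top_of_le_ne_top ENNReal.one_ne_top ?_
  rw [← sum_hitMatrix (rowSum_green_finset_ne_top hfin ha i)]
  exact Finset.single_le_sum (f := fun r : {x // x ∈ A} => hitMatrix P A i r)
    (fun _ _ => zero_le) (Finset.mem_univ r)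

theorem sum_toReal_hitMatrix (hfin : ∀ i, rowSum (green P {a}) i ≠ ∞) (ha : a ∈ A) (i : E) :
    ∑ r : {x // x ∈ A}, (hitMatrix P A i r).toReal = 1 := by
  rw [← ENNReal.toReal_sum fun r _ => hitMatrix_ne_top hfin ha i r,
    sum_hitMatrix (rowSum_green_finset_ne_top hfin ha i), ENNReal.toReal_one]

/-- The time to reach `a` is the time to reach `A` plus the remaining time, absent when `A` is
entered at `a`. -/
theorem toReal_rowSum_green_eq (hfin : ∀ i, rowSum (green P {a}) i ≠ ∞) (ha : a ∈ A) (i : E) :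
    (rowSum (green P {a}) i).toReal = (rowSum (green P A) i).toReal +
      ∑ r : {x // x ∈ A}, (hitMatrix P A i r).toReal *
        (if (r : E) = a then 0 else (rowSum (green P {a}) r).toReal) := by
  have hterm : ∀ r : {x // x ∈ A},
      hitMatrix P A i r * (if (r : E) = a then 0 else rowSum (green P {a}) r) ≠ ∞ := fun r =>
    ENNReal.mul_ne_top (hitMatrix_ne_top hfin ha i r) (by split_ifs <;> simp [hfin])
  rw [rowSum_green_singleton_eq ha i, ENNReal.toReal_add (rowSum_green_finset_ne_top hfin ha i)
    (ENNReal.sum_ne_top.2 fun r _ => hterm r), ENNReal.toReal_sum fun r _ => hterm r]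
  congr 1
  refine Finset.sum_congr rfl fun r _ => ?_
  rw [ENNReal.toReal_mul]
  split_ifs <;> simp

theorem toReal_green_eq (hfin : ∀ i, rowSum (green P {a}) i ≠ ∞) (ha : a ∈ A) (i j : E) :
    (green P {a} i j).toReal = (green P A i j).toReal +
      ∑ r : {x // x ∈ A}, (hitMatrix P A i r).toReal *
        (if (r : E) = a then 0 else (green P {a} r j).toReal) := by
  have hG : ∀ r, green P {a} r j ≠ ∞ := fun r =>
    ne_top_of_le_ne_top (hfin r) (apply_le_rowSum _ _ _)
  have hterm : ∀ r : {x // x ∈ A},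
      hitMatrix P A i r * (if (r : E) = a then 0 else green P {a} r j) ≠ ∞ := fun r =>
    ENNReal.mul_ne_top (hitMatrix_ne_top hfin ha i r) (by split_ifs <;> simp [hG])
  rw [green_singleton_eq ha i, ENNReal.toReal_add
    (ne_top_of_le_ne_top (rowSum_green_finset_ne_top hfin ha i) (apply_le_rowSum _ _ _))
    (ENNReal.sum_ne_top.2 fun r _ => hterm r), ENNReal.toReal_sum fun r _ => hterm r]
  congr 1
  refine Finset.sum_congr rfl fun r _ => ?_
  rw [ENNReal.toReal_mul]
  split_ifs <;> simp

/-- The matrix `G - (G e) pᵀ` of the Green matrix `G` of a killed chain. -/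
def centeredGreen (P : E → PMF E) (p : PMF E) (S : Set E) : Matrix E E ℝ :=
  fun i j => (green P S i j).toReal - (rowSum (green P S) i).toReal * (p j).toReal

theorem centeredGreen_self (hirr : IsIrreducible P) {p : PMF E} (hp : IsInvariant P p) (j : E) :
    centeredGreen P p {a} a j = 0 := by
  rw [centeredGreen, green_self_eq hirr hp, ENNReal.toReal_mul, mul_comm, sub_self]

/-- The Poisson equation for the chain observed at its visits to `A`. -/
theorem centeredGreen_singleton_eq (hirr : IsIrreducible P) {p : PMF E} (hp : IsInvariant P p)
    (hfin : ∀ i, rowSum (green P {a}) i ≠ ∞) (ha : a ∈ A) (i j : E) :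
    centeredGreen P p {a} i j = centeredGreen P p A i j +
      ∑ r : {x // x ∈ A}, (hitMatrix P A i r).toReal * centeredGreen P p {a} r j := by
  -- Row `a` of the centered matrix is zero, so the term r = a may be restored without changing the
  -- sum.
  have hterm : ∀ r : {x // x ∈ A}, (hitMatrix P A i r).toReal * centeredGreen P p {a} r j =
      (hitMatrix P A i r).toReal * (if (r : E) = a then 0 else (green P {a} r j).toReal) -
      (hitMatrix P A i r).toReal *
        (if (r : E) = a then 0 else (rowSum (green P {a}) r).toReal) * (p j).toReal := fun r => by
    split_ifs with h
    · rw [h, centeredGreen_self hirr hp]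
      ring
    · rw [centeredGreen]
      ring
  simp only [hterm, Finset.sum_sub_distrib, ← Finset.sum_mul]
  rw [centeredGreen, centeredGreen, toReal_green_eq hfin ha, toReal_rowSum_green_eq hfin ha]
  ring

/-- The right-hand factor in the definition of `solutionA`. -/
theorem hcat_sub_vecMulVec_eq (p : PMF E) (hfin : ∀ i, rowSum (green P {a}) i ≠ ∞) (ha : a ∈ A) :
    hcat A 1 ((hatAB P A).map ENNReal.toReal) -
      Matrix.vecMulVec (fun i => 1 + (rowSum (hatAB P A) i).toReal) (fun j => (p j).toReal) =
    Matrix.of fun (i : {x // x ∈ A}) j => centeredGreen P p A i j := by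
  ext i j
  rw [Matrix.sub_apply, Matrix.vecMulVec_apply, Matrix.of_apply, centeredGreen, ← rowSum_hatAB_eq,
    ENNReal.toReal_add ENNReal.one_ne_top (rowSum_hatAB_ne_top hfin ha i), ENNReal.toReal_one]
  congr 1
  rw [hcat]
  split_ifs with h
  · rw [green_of_mem (by simpa using h), Matrix.one_apply, Matrix.one_apply]
    simp only [Subtype.ext_iff]
    split_ifs <;> simp
  · rw [Matrix.map_apply, hatAB_eq]

variable {Ω : Type*} [MeasurableSpace Ω] {μ : E → Measure Ω} {Φ : ℕ → Ω → E}

/-- P̂_BB P_BA is the law of the entrance into `A` from `B`, so X̃_B obeys the relation that K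
satisfies on `B`. -/
theorem solutionB_apply (p : PMF E) (i : {x // x ∉ A}) (j : E) :
    solutionB P A μ Φ p i j = ∑ r : {x // x ∈ A},
      (hitMatrix P A i r).toReal * solutionA P A μ Φ p r j + centeredGreen P p A i j := by
  rw [solutionB, Matrix.sub_apply, Matrix.add_apply, Matrix.mul_apply, Matrix.vecMulVec_apply,
    centeredGreen, add_sub_assoc, rowSum_hatBB_eq]
  congr 1
  · refine Finset.sum_congr rfl fun r _ => ?_
    rw [hitMatrix_of_notMem]
    rfl
  · congr 1
    rw [hcat]
    split_ifs with h
    · rw [green_of_mem (by simpa using h),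
        Matrix.one_apply_ne (fun hij => i.2 (by rw [hij]; exact h))]
      simp
    · rw [Matrix.map_apply, hatBB_eq]

variable [Countable E] [MeasurableSpace E] [MeasurableSingletonClass E]

theorem IsMarkovChain.censored_apply (hΦ : IsMarkovChain P μ Φ) (i j : {x // x ∈ A}) :
    censored A μ Φ i j = hitMatrix P A i j :=
  hΦ.measure_returnTime i (by simp)

theorem IsMarkovChain.censored_eq (hΦ : IsMarkovChain P μ Φ) :
    censored A μ Φ = blockAA P A + infMul (hatAB P A) (blockBA P A) := by
  ext i j
  rw [hΦ.censored_apply, hitMatrix_of_mem]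
  rfl

theorem IsMarkovChain.oneSubCensored_eq (hΦ : IsMarkovChain P μ Φ) :
    oneSubCensored A μ Φ =
      1 - Matrix.of fun i j : {x // x ∈ A} => (hitMatrix P A i j).toReal := by
  rw [oneSubCensored]
  congr 1
  ext i j
  rw [Matrix.map_apply, hΦ.censored_apply, Matrix.of_apply]

/-- The mean return time to `a` serves as the function `T`: under the censored chain killed at `a`
it drops by the mean return time to `A`, which is positive. -/
theorem eq_const_of_oneSubCensored_mulVec_eq_zero (hΦ : IsMarkovChain P μ Φ)
    (hfin : ∀ i, rowSum (green P {a}) i ≠ ∞) (ha : a ∈ A) (x : {x // x ∈ A} → ℝ)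
    (hx : (oneSubCensored A μ Φ).mulVec x = 0) : x = x ⟨a, ha⟩ • 1 := by
  rw [hΦ.oneSubCensored_eq] at hx
  have hpos : ∀ i, 0 < (rowSum (green P A) i).toReal := fun i => by
    refine ENNReal.toReal_pos (fun h => ?_) (rowSum_green_finset_ne_top hfin ha i)
    rw [rowSum_green] at h
    simp at h
  have heq := toReal_rowSum_green_eq (A := A) hfin ha
  refine eq_const_of_sub_stochastic_mulVec_eq_zero (m := {x // x ∈ A})
    (Q := Matrix.of fun i j => (hitMatrix P A i j).toReal) (fun i j => ENNReal.toReal_nonneg)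
    (fun i => sum_toReal_hitMatrix hfin ha i) ⟨a, ha⟩
    (fun i => (rowSum (green P {a}) i).toReal) (fun i => ?_) (fun i => ?_) x hx
  · refine (hpos i).trans_le (ENNReal.toReal_mono (hfin i) ?_)
    exact rowSum_green_anti (by simpa using ha) _
  · simp only [heq i, Matrix.of_apply, Subtype.ext_iff]
    exact lt_add_of_pos_left _ (hpos i)

theorem isGroupInverse_oneSubCensored (hΦ : IsMarkovChain P μ Φ)
    (hfin : ∀ i, rowSum (green P {a}) i ≠ ∞) (ha : a ∈ A) :
    IsGroupInverse (oneSubCensored A μ Φ) (groupInverse (oneSubCensored A μ Φ)) := by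
  have : Nonempty {x // x ∈ A} := ⟨⟨a, ha⟩⟩
  have h_one : (oneSubCensored A μ Φ).mulVec 1 = 0 := by
    rw [hΦ.oneSubCensored_eq, Matrix.sub_mulVec, Matrix.one_mulVec, sub_eq_zero]
    funext i
    simp only [Matrix.mulVec, dotProduct, Matrix.of_apply, Pi.one_apply, mul_one,
      sum_toReal_hitMatrix hfin ha]
  have h_range : ∀ x (c : ℝ), (oneSubCensored A μ Φ).mulVec x = c • 1 → c = 0 := by
    rw [hΦ.oneSubCensored_eq]
    exact eq_zero_of_sub_stochastic_mulVec_eq (fun i j => ENNReal.toReal_nonneg)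
      (fun i => sum_toReal_hitMatrix hfin ha i)
  obtain ⟨G, hG⟩ := exists_isGroupInverse h_one
    (fun x hx => ⟨_, eq_const_of_oneSubCensored_mulVec_eq_zero hΦ hfin ha x hx⟩) h_range
  exact isGroupInverse_groupInverse hG

/-- Since X̃_A = W^# W K_A, the identity W W^# W = W puts each column of X̃_A - K_A in the kernel of
W, the constants. The value is read off at `a`, where K vanishes. -/
theorem solutionA_eq (hΦ : IsMarkovChain P μ Φ) (hirr : IsIrreducible P) {p : PMF E}
    (hp : IsInvariant P p) (hfin : ∀ i, rowSum (green P {a}) i ≠ ∞) (ha : a ∈ A)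
    (i : {x // x ∈ A}) (j : E) :
    solutionA P A μ Φ p i j = centeredGreen P p {a} i j + solutionA P A μ Φ p ⟨a, ha⟩ j := by
  set W := oneSubCensored A μ Φ with hW
  set K : Matrix {x // x ∈ A} E ℝ := Matrix.of fun i j => centeredGreen P p {a} i j with hK
  have hWK : W * K = Matrix.of fun (i : {x // x ∈ A}) j => centeredGreen P p A i j := by
    rw [hW, hΦ.oneSubCensored_eq, Matrix.sub_mul, Matrix.one_mul]
    ext i j
    rw [Matrix.sub_apply, Matrix.mul_apply, Matrix.of_apply, hK, Matrix.of_apply,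
      centeredGreen_singleton_eq hirr hp hfin ha]
    simp only [Matrix.of_apply]
    ring
  have hX : solutionA P A μ Φ p = groupInverse W * (W * K) := by
    rw [solutionA, hcat_sub_vecMulVec_eq p hfin ha, hWK]
  have hWX : W * (solutionA P A μ Φ p - K) = 0 := by
    rw [Matrix.mul_sub, hX, ← Matrix.mul_assoc, ← Matrix.mul_assoc,
      (isGroupInverse_oneSubCensored hΦ hfin ha).mul_mul_self, sub_self]
  have hconst := eq_const_of_oneSubCensored_mulVec_eq_zero hΦ hfin ha
    (fun r => (solutionA P A μ Φ p - K) r j) (by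
      funext r
      exact congrFun (congrFun hWX r) j)
  have := congrFun hconst i
  simp only [Pi.smul_apply, Pi.one_apply, smul_eq_mul, mul_one, Matrix.sub_apply, hK,
    Matrix.of_apply, centeredGreen_self hirr hp, sub_zero] at this
  linarith

theorem solution_eq (hΦ : IsMarkovChain P μ Φ) (hirr : IsIrreducible P) {p : PMF E}
    (hp : IsInvariant P p) (hfin : ∀ i, rowSum (green P {a}) i ≠ ∞) (ha : a ∈ A) (i j : E) :
    solution P A μ Φ p i j = centeredGreen P p {a} i j + solution P A μ Φ p a j := by
  have hsa : solution P A μ Φ p a j = solutionA P A μ Φ p ⟨a, ha⟩ j := by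
    rw [solution, dif_pos ha]
  rw [hsa, solution]
  split_ifs with h
  · exact solutionA_eq hΦ hirr hp hfin ha ⟨i, h⟩ j
  · rw [solutionB_apply, centeredGreen_singleton_eq hirr hp hfin ha i j]
    rw [Finset.sum_congr rfl fun r _ => by rw [solutionA_eq hΦ hirr hp hfin ha r j, mul_add],
      Finset.sum_add_distrib, ← Finset.sum_mul, sum_toReal_hitMatrix hfin ha]
    ring

end Censored

end

end CensoredPoisson

theorem theorem2 {E Ω : Type*} [Countable E] [DecidableEq E] [MeasurableSpace E]
    [MeasurableSingletonClass E] [MeasurableSpace Ω]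
    (P : E → PMF E) (μ : E → MeasureTheory.Measure Ω) (Φ : ℕ → Ω → E) (p : PMF E)
    (hΦ : CensoredPoisson.IsMarkovChain P μ Φ)
    (hirr : CensoredPoisson.IsIrreducible P)
    (hpos : CensoredPoisson.IsPositiveRecurrent μ Φ)
    (hp : CensoredPoisson.IsInvariant P p)
    (A : Finset E) (α : E) (hα : α ∈ A) :
    -- the quantities in `K` are well defined
    (∀ i, ∀ᵐ ω ∂(μ i), CensoredPoisson.returnTime Φ {α} ω ≠ ⊤) ∧
    (∀ i j, MeasureTheory.Integrable (CensoredPoisson.additiveFunctional p Φ α j) (μ i)) ∧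
    -- the quantities in `X̃` are well defined, and `P^(A) = P_AA + P_AB P̂_BB P_BA`
    (∀ i, CensoredPoisson.rowSum (CensoredPoisson.hatBB P A) i ≠ ⊤) ∧
    (∀ i, CensoredPoisson.rowSum (CensoredPoisson.hatAB P A) i ≠ ⊤) ∧
    CensoredPoisson.censored A μ Φ = CensoredPoisson.blockAA P A +
      CensoredPoisson.infMul (CensoredPoisson.hatAB P A) (CensoredPoisson.blockBA P A) ∧
    CensoredPoisson.IsGroupInverse (CensoredPoisson.oneSubCensored A μ Φ)
      (CensoredPoisson.groupInverse (CensoredPoisson.oneSubCensored A μ Φ)) ∧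
    -- `K = X̃ - e βᵀ` with `β j = X̃ α j`
    CensoredPoisson.additiveMatrix p μ Φ α =
      CensoredPoisson.solution P A μ Φ p -
        Matrix.vecMulVec (fun _ => (1 : ℝ)) (fun j => CensoredPoisson.solution P A μ Φ p α j) := by
  -- Positive recurrence at `α` is the finiteness of the mean cycle length; irreducibility extends
  -- it to all starting states.
  have hfin_self : CensoredPoisson.rowSum (CensoredPoisson.green P {α}) α ≠ ∞ := by
    rw [← hΦ.lintegral_returnTime]
    exact (hpos α).ne
  have hfin := CensoredPoisson.rowSum_green_ne_top hirr hfin_self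
  refine ⟨fun i => hΦ.ae_returnTime_ne_top (hfin i),
    fun i j => hΦ.integrable_additiveFunctional (hfin i) p j,
    CensoredPoisson.rowSum_hatBB_ne_top hfin hα, CensoredPoisson.rowSum_hatAB_ne_top hfin hα,
    hΦ.censored_eq, CensoredPoisson.isGroupInverse_oneSubCensored hΦ hfin hα, ?_⟩
  ext i j
  rw [hΦ.additiveMatrix_eq (hfin i), Matrix.sub_apply, Matrix.vecMulVec_apply, one_mul,
    CensoredPoisson.solution_eq hΦ hirr hp hfin hα i j, add_sub_cancel_right]
  rfl
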